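/- Let $\kappa$ be an infinite cardinal. All graphs are simple and undirected. A \emph{$\kappa$-graph} is a connected graph with at most $\kappa$ vertices. An \emph{infinite trail} in a graph is an infinite sequence $v_0,v_1,v_2,\dots$ of vertices such that $v_nv_{n+1}$ is an edge for every $n$ and these edges are pairwise distinct (vertices may repeat). Ranks are defined recursively: a graph has rank $0$ iff it is finite; for an ordinal $\alpha>0$, a graph $G$ has rank $\alpha$ iff it has no smaller rank and there is a finite subgraph $F\subseteq G$ such that every connected component of $G-F$ has rank smaller than $\alpha$. Let $\mathbf B_\kappa$ be the class of $\kappa$-graphs without infinite trails and, for an ordinal $\alpha$, let $\mathbf B_\kappa^\alpha$ be the class of those $G\in\mathbf B_\kappa$ that have rank strictly less than $\alpha$. A \emph{strong immersion} $\Phi:G\to H$ is an isomorphism from $G$ onto an induced subgraph of $H$. An \emph{ear} of a subgraph $K$ of $G$ is either a path in $G$ with two distinct ends that meets $K$ in exactly its two end vertices and uses no edge of $K$, or a cycle in $G$ that meets $K$ in exactly one vertex. For a class $\mathcal C$ of graphs, $\mathrm{Stc}(\mathcal C)$ is the least cardinality of a family $\mathcal F\subseteq\mathcal C$ such that every $G\in\mathcal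 C$ has a strong immersion into some $H\in\mathcal F$. \textbf{Theorem.} For every ordinal $\alpha$ with $0<\alpha<\kappa^+$ there is a family $\mathcal F_\kappa^\alpha\subseteq\mathbf B_\kappa^\alpha$ such that (1) for every $G\in\mathbf B_\kappa^\alpha$ and every finite subgraph $K\subseteq G$ there are $H\in\mathcal F_\kappa^\alpha$ and a strong immersion $\Phi:G\to H$ such that, if there is no ear of $K$ in $G$, then there is no ear of $\Phi[K]$ in $H$; (2) $|\mathcal F_\kappa^\alpha|\le\kappa$. Moreover, $\mathrm{Stc}(\mathbf B_\kappa)=\kappa^+$. -/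

import Mathlib

open Cardinal

universe u

/-- A (simple, undirected) graph together with its vertex type. -/
structure BundledGraph : Type (u + 1) where
  /-- The vertex type. -/
  V : Type u
  /-- The adjacency structure. -/
  graph : SimpleGraph V

/-- `HasRank α G`: the graph `G` has rank `α` in the rayless hierarchy.
A graph has rank `0` iff it is finite. For `α > 0` it has rank `α` iff it does not have a smaller
rank and there is a finite set `F` of vertices (the vertex set of a kernel) such that every
connected component of `G - F` has rank smaller than `α`. -/
def HasRank (α : Ordinal.{u}) {V : Type u} (G : SimpleGraph V) : Prop :=
  (α = 0 ∧ Finite V) ∨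
  (α ≠ 0 ∧ (∀ β, ∀ _h : β < α, ¬ HasRank β G) ∧
    ∃ F : Set V, F.Finite ∧ ∀ C : (G.induce Fᶜ).ConnectedComponent,
      ∃ β, ∃ _h : β < α, HasRank β C.toSimpleGraph)
termination_by α

/-- An infinite trail: an infinite sequence of consecutively adjacent vertices (with a first
vertex) that may repeat vertices but never traverses the same edge twice. -/
def IsInfiniteTrail {V : Type u} (G : SimpleGraph V) (v : ℕ → V) : Prop :=
  (∀ n, G.Adj (v n) (v (n + 1))) ∧ Function.Injective fun n => s(v n, v (n + 1))

/-- The class of `κ`-graphs without infinite trails: connected graphs with at most `κ` vertices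
that contain no infinite trail. -/
def trailFree (κ : Cardinal.{u}) : Set BundledGraph.{u} :=
  {G | G.graph.Connected ∧ #G.V ≤ κ ∧ ¬ ∃ v : ℕ → G.V, IsInfiniteTrail G.graph v}

/-- The subclass of `trailFree κ` of the graphs of rank strictly less than `α`. -/
def trailFreeBelow (κ : Cardinal.{u}) (α : Ordinal.{u}) : Set BundledGraph.{u} :=
  {G | G ∈ trailFree κ ∧ ∃ β < α, HasRank β G.graph}

/-- There is an open ear of `K` in `G`: a path of `G` between two distinct vertices of `K` that
meets `K` in exactly its two ends (and, as usual, does not use an edge of `K`). -/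
def HasOpenEar {V : Type u} {G : SimpleGraph V} (K : G.Subgraph) : Prop :=
  ∃ (u v : V) (p : G.Walk u v), p.IsPath ∧ u ≠ v ∧
    (∀ w ∈ p.support, w ∈ K.verts ↔ w = u ∨ w = v) ∧ ∀ e ∈ p.edges, e ∉ K.edgeSet

/-- There is a closed ear of `K` in `G`: a cycle of `G` that meets `K` in exactly one vertex (at
which, without loss of generality, the cycle is based). -/
def HasClosedEar {V : Type u} {G : SimpleGraph V} (K : G.Subgraph) : Prop :=
  ∃ (u : V) (c : G.Walk u u), c.IsCycle ∧ ∀ w ∈ c.support, w ∈ K.verts ↔ w = u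

/-- There is an ear (open or closed) of `K` in `G`. -/
def HasEar {V : Type u} {G : SimpleGraph V} (K : G.Subgraph) : Prop :=
  HasOpenEar K ∨ HasClosedEar K

/-- A family `F` is strongly universal in the class `𝒞` if `F ⊆ 𝒞` and every member of `𝒞` has a
strong immersion (an isomorphism onto an induced subgraph) into some member of `F`. -/
def IsStronglyUniversal (F 𝒞 : Set BundledGraph.{u}) : Prop :=
  F ⊆ 𝒞 ∧ ∀ G ∈ 𝒞, ∃ H ∈ F, Nonempty (G.graph ↪g H.graph)

/-- The strong complexity of a class: the least cardinality of a strongly universal family. (If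
there is none, the value is `0`; a nonzero value is always attained.) -/
noncomputable def strongComplexity (𝒞 : Set BundledGraph.{u}) : Cardinal.{u + 1} :=
  sInf {c | ∃ F : Set BundledGraph.{u}, IsStronglyUniversal F 𝒞 ∧ #F = c}

/-! When no trail is infinite, the tree of continuations of a trail is well-founded. Induction over
it gives two structural facts. Every finite vertex set lies in a finite connected set `Y` to which
each component of the rest sends at most one edge (`exists_bridgeClosed_superset`). Every member of
`trailFree κ` has a rank below κ⁺, because κ⁺ is regular (`rankLT_of_mem_trailFree`).

Choose `Y` to contain `K` and a kernel of a graph of rank at most β. The graph is then a finite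
graph with pieces of rank below β, each hanging on one edge. Hosts for all such graphs arise from
the finite connected graphs by attaching, at each vertex, κ copies of every rooted member of a
family for ranks below β (`HasSmallFamily.succ`). A trail between base vertices cannot enter a copy
and return, so no infinite trail appears and every ear of the image of `K` comes from an ear of `K`.
Unions over smaller ranks complete the recursion (`hasSmallFamily`).

The union over all α < κ⁺ bounds the complexity from above. For the lower bound, hang ℵ₀ copies of
each of at most κ given members on one vertex. If some member contained the result, a finite kernel
would miss a whole copy of that member, whose rank would then be smaller than itself
(`exists_not_embedding`). -/

/-! ### Bounds on the rank -/

/-- The graph `G` has a rank, and its rank is less than `α`. -/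
def RankLT (α : Ordinal.{u}) {V : Type u} (G : SimpleGraph V) : Prop :=
  ∃ β < α, HasRank β G

theorem RankLT.mono {α β : Ordinal.{u}} {V : Type u} {G : SimpleGraph V} (h : RankLT α G)
    (hαβ : α ≤ β) : RankLT β G :=
  let ⟨γ, hγ, hG⟩ := h
  ⟨γ, hγ.trans_le hαβ, hG⟩

theorem HasRank.rankLT_succ {α : Ordinal.{u}} {V : Type u} {G : SimpleGraph V}
    (h : HasRank α G) : RankLT (Order.succ α) G :=
  ⟨α, Order.lt_succ α, h⟩

theorem not_rankLT_zero {V : Type u} {G : SimpleGraph V} : ¬ RankLT 0 G :=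
  fun ⟨β, hβ, _⟩ => (not_lt_bot : ¬ β < ⊥) hβ

theorem rankLT_succ_iff_component {α : Ordinal.{u}} {V : Type u} {G : SimpleGraph V} :
    RankLT (Order.succ α) G ↔
      ∃ F : Set V, F.Finite ∧ ∀ C : (G.induce Fᶜ).ConnectedComponent,
        RankLT α C.toSimpleGraph := by
  constructor
  · rintro ⟨β, hβ, h⟩
    rw [HasRank] at h
    rcases h with ⟨-, hfin⟩ | ⟨-, -, F, hF, hC⟩
    · refine ⟨Set.univ, Set.toFinite _, fun C => ?_⟩
      obtain ⟨⟨x, hx⟩, -⟩ := C.nonempty_supp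
      exact absurd (Set.mem_univ x) hx
    · refine ⟨F, hF, fun C => ?_⟩
      obtain ⟨γ, hγ, h⟩ := hC C
      exact ⟨γ, hγ.trans_le (Order.lt_succ_iff.1 hβ), h⟩
  · rintro ⟨F, hF, hC⟩
    by_cases hlt : RankLT α G
    · exact hlt.mono (Order.le_succ α)
    refine ⟨α, Order.lt_succ α, ?_⟩
    rw [HasRank]
    by_cases hα : α = 0
    · refine Or.inl ⟨hα, ?_⟩
      subst hα
      have : F = Set.univ := Set.eq_univ_iff_forall.2 fun x => by
        by_contra hx
        exact not_rankLT_zero (hC ((G.induce Fᶜ).connectedComponentMk ⟨x, hx⟩))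
      exact Set.finite_univ_iff.1 (this ▸ hF)
    · refine Or.inr ⟨hα, fun β hβ h => hlt ⟨β, hβ, h⟩, F, hF, fun C => ?_⟩
      obtain ⟨γ, hγ, h⟩ := hC C
      exact ⟨γ, hγ, h⟩

/-- A homomorphism from a preconnected graph lands in the component of any of its values. -/
def homToComponent {V W : Type*} {G : SimpleGraph V} {H : SimpleGraph W} (hG : G.Preconnected)
    (f : G →g H) (v : V) : G →g (H.connectedComponentMk (f v)).toSimpleGraph where
  toFun x := ⟨f x, SimpleGraph.ConnectedComponent.sound ((hG x v).map f)⟩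
  map_rel' h := f.map_rel h

/-- The preimage of a kernel is a kernel: injectivity keeps it finite, and each remaining component
maps into a single component of the target. -/
theorem RankLT.of_injective {α : Ordinal.{u}} {V W : Type u} {G : SimpleGraph V}
    {H : SimpleGraph W} (h : RankLT α H) (f : G →g H) (hf : Function.Injective f) :
    RankLT α G := by
  obtain ⟨β, hβ, h⟩ := h
  refine RankLT.mono ?_ (Order.succ_le_of_lt hβ)
  replace h := h.rankLT_succ
  clear hβ
  induction β using WellFoundedLT.induction generalizing V W with
  | ind β ih =>
    rw [rankLT_succ_iff_component] at h ⊢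
    obtain ⟨F, hF, hC⟩ := h
    refine ⟨f ⁻¹' F, hF.preimage hf.injOn, fun C => ?_⟩
    obtain ⟨v, hv⟩ := C.nonempty_supp
    let g : C.toSimpleGraph →g H.induce Fᶜ :=
      ⟨fun x => ⟨f x.1.1, x.1.2⟩, fun h => f.map_rel h⟩
    have hg : Function.Injective g := fun x y hxy =>
      Subtype.ext (Subtype.ext (hf (congrArg Subtype.val hxy)))
    obtain ⟨γ, hγ, h⟩ := hC ((H.induce Fᶜ).connectedComponentMk (g ⟨v, hv⟩))
    refine (ih γ hγ (homToComponent C.connected_toSimpleGraph.preconnected g ⟨v, hv⟩) ?_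
      h.rankLT_succ).mono (Order.succ_le_of_lt hγ)
    exact fun x y hxy => hg (congrArg Subtype.val hxy)

/-- By monotonicity of rank, components may be replaced by arbitrary connected sets off the kernel,
which are easier to transport. -/
theorem rankLT_succ_iff {α : Ordinal.{u}} {V : Type u} {G : SimpleGraph V} :
    RankLT (Order.succ α) G ↔
      ∃ F : Set V, F.Finite ∧ ∀ T : Set V, T ⊆ Fᶜ → (G.induce T).Connected →
        RankLT α (G.induce T) := by
  rw [rankLT_succ_iff_component]
  refine exists_congr fun F => and_congr_right fun _ => ⟨fun h T hT hconn => ?_, fun h C => ?_⟩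
  · obtain ⟨t⟩ := hconn.nonempty
    let g : G.induce T →g G.induce Fᶜ := ⟨fun x => ⟨x.1, hT x.2⟩, fun h => h⟩
    refine (h _).of_injective (homToComponent hconn.preconnected g t) fun x y hxy => ?_
    exact Subtype.ext (congrArg (fun z => z.1.1) hxy)
  · let g : C.toSimpleGraph →g G.induce (Subtype.val '' C.supp) :=
      ⟨fun x => ⟨x.1.1, x.1, x.2, rfl⟩, fun h => h⟩
    refine (h (Subtype.val '' C.supp) ?_ ?_).of_injective g fun x y hxy => ?_
    · rintro _ ⟨x, -, rfl⟩
      exact x.2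
    · refine C.connected_toSimpleGraph.map g ?_
      rintro ⟨_, x, hx, rfl⟩
      exact ⟨⟨x, hx⟩, rfl⟩
    · have : x.1.1 = y.1.1 := congrArg (fun z => z.1) hxy
      exact Subtype.ext (Subtype.ext this)

/-! ### Connected sets and bridge-closed sets -/

/-- The spanning subgraph of `G` formed by the edges with both ends in `X`. -/
def SimpleGraph.within {V : Type*} (G : SimpleGraph V) (X : Set V) : SimpleGraph V where
  Adj a b := G.Adj a b ∧ a ∈ X ∧ b ∈ X
  symm := ⟨fun _ _ h => ⟨h.1.symm, h.2.2, h.2.1⟩⟩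
  loopless := ⟨fun _ h => G.loopless.irrefl _ h.1⟩

section Within

variable {V : Type*} {G H : SimpleGraph V} {X Y S : Set V}

theorem SimpleGraph.within_le : G.within X ≤ G := fun _ _ h => h.1

theorem SimpleGraph.within_mono_right (h : X ⊆ Y) : G.within X ≤ G.within Y :=
  fun _ _ hab => ⟨hab.1, h hab.2.1, h hab.2.2⟩

theorem SimpleGraph.within_mono_left (h : G ≤ H) : G.within X ≤ H.within X :=
  fun _ _ hab => ⟨h hab.1, hab.2⟩

theorem SimpleGraph.Reachable.mem_of_within {a b : V} (h : (G.within X).Reachable a b)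
    (ha : a ∈ X) : b ∈ X := by
  rw [SimpleGraph.reachable_iff_reflTransGen] at h
  induction h with
  | refl => exact ha
  | tail _ hbc _ => exact hbc.2.2

theorem SimpleGraph.Reachable.induce_of_within {a b : V} (h : (G.within X).Reachable a b)
    (ha : a ∈ X) (hb : b ∈ X) : (G.induce X).Reachable ⟨a, ha⟩ ⟨b, hb⟩ := by
  rw [SimpleGraph.reachable_iff_reflTransGen] at h
  induction h with
  | refl => exact .rfl
  | tail _ hbc ih =>
    exact (ih hbc.2.1).trans (SimpleGraph.Adj.reachable (by exact hbc.1))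

/-- The last edge before the first visit to `S`. -/
theorem SimpleGraph.Reachable.exists_adj_mem {a b : V} (h : G.Reachable a b) (ha : a ∉ S)
    (hb : b ∈ S) :
    ∃ y x, (G.within Sᶜ).Reachable a y ∧ G.Adj y x ∧ y ∉ S ∧ x ∈ S := by
  rw [SimpleGraph.reachable_iff_reflTransGen] at h
  induction h using Relation.ReflTransGen.head_induction_on with
  | refl => exact absurd hb ha
  | @head a c hac _ ih =>
    by_cases hc : c ∈ S
    · exact ⟨a, c, .rfl, hac, ha, hc⟩
    · obtain ⟨y, x, hy, h⟩ := ih hc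
      exact ⟨y, x, (SimpleGraph.Adj.reachable (by exact ⟨hac, ha, hc⟩)).trans hy, h⟩

/-- The set `X` induces a preconnected subgraph of `G`. -/
def SimpleGraph.ConnectedOn (G : SimpleGraph V) (X : Set V) : Prop :=
  ∀ a ∈ X, ∀ b ∈ X, (G.within X).Reachable a b

theorem SimpleGraph.ConnectedOn.mono_left (h : G.ConnectedOn X) (hle : G ≤ H) :
    H.ConnectedOn X :=
  fun a ha b hb => (h a ha b hb).mono (within_mono_left hle)

theorem SimpleGraph.ConnectedOn.union (hX : G.ConnectedOn X) (hY : G.ConnectedOn Y) {a b : V}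
    (ha : a ∈ X) (hb : b ∈ Y) (hab : (G.within (X ∪ Y)).Reachable a b) :
    G.ConnectedOn (X ∪ Y) := by
  have key : ∀ c ∈ X ∪ Y, (G.within (X ∪ Y)).Reachable a c := by
    rintro c (hc | hc)
    · exact (hX a ha c hc).mono (within_mono_right Set.subset_union_left)
    · exact hab.trans ((hY b hb c hc).mono (within_mono_right Set.subset_union_right))
  exact fun c hc d hd => (key c hc).symm.trans (key d hd)

/-- Every component of `G - X` is joined to `X` by at most one edge. -/
def SimpleGraph.BridgeClosed (G : SimpleGraph V) (X : Set V) : Prop :=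
  ∀ ⦃x y x' y'⦄, x ∈ X → x' ∈ X → y ∉ X → y' ∉ X → G.Adj x y → G.Adj x' y' →
    (G.within Xᶜ).Reachable y y' → x = x' ∧ y = y'

/-- Edges inside `Y` play no role in the condition, so an edge deleted there can be restored. -/
theorem SimpleGraph.BridgeClosed.of_adj (h : H.BridgeClosed Y)
    (hadj : ∀ a b, G.Adj a b → H.Adj a b ∨ (a ∈ Y ∧ b ∈ Y)) : G.BridgeClosed Y := by
  intro x y x' y' hx hx' hy hy' hxy hxy' hr
  refine h hx hx' hy hy' ((hadj _ _ hxy).resolve_right fun h => hy h.2)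
    ((hadj _ _ hxy').resolve_right fun h => hy' h.2) (hr.mono fun a b hab => ?_)
  exact ⟨(hadj _ _ hab.1).resolve_right fun h => hab.2.1 h.1, hab.2⟩

theorem SimpleGraph.BridgeClosed.union (hX : G.BridgeClosed X) (hY : H.BridgeClosed Y)
    (hadj : ∀ a b, G.Adj a b → H.Adj a b ∨ (a ∈ X ∪ Y ∧ b ∈ X ∪ Y)) (hne : X.Nonempty)
    (hconn : G.ConnectedOn (X ∪ Y)) : G.BridgeClosed (X ∪ Y) := by
  have hsub : G.within (X ∪ Y)ᶜ ≤ G.within Xᶜ :=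
    within_mono_right (Set.compl_subset_compl.2 Set.subset_union_left)
  have key : ∀ ⦃x y x' y'⦄, x ∈ X → x' ∈ X ∪ Y → y ∉ X ∪ Y → y' ∉ X ∪ Y → G.Adj x y →
      G.Adj x' y' → (G.within (X ∪ Y)ᶜ).Reachable y y' → x = x' ∧ y = y' := by
    intro x y x' y' hx hx' hy hy' hxy hxy' hr
    have hyX : y ∉ X := fun h => hy (Or.inl h)
    have hyX' : y' ∉ X := fun h => hy' (Or.inl h)
    by_cases hxX : x' ∈ X
    · exact hX hx hxX hyX hyX' hxy hxy' (hr.mono hsub)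
    · obtain ⟨z, hz⟩ := hne
      -- Continue from `x'` inside `X ∪ Y` until `X` is met. The component of `y` in `G - X` then
      -- has a second edge to `X`, whose outer end lies in `X ∪ Y`, unlike `y`.
      obtain ⟨y₂, x₂, hr₂, hadj₂, hy₂, hx₂⟩ :=
        (hconn x' hx' z (Or.inl hz)).exists_adj_mem hxX hz
      have hyy : (G.within Xᶜ).Reachable y y₂ :=
        ((hr.mono hsub).trans (SimpleGraph.Adj.reachable (by exact ⟨hxy'.symm, hyX', hxX⟩))).trans
          (hr₂.mono (within_mono_left within_le))
      obtain ⟨-, rfl⟩ := hX hx hx₂ hyX hy₂ hxy hadj₂.1.symm hyy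
      exact absurd hadj₂.2.1 hy
  intro x y x' y' hx hx' hy hy' hxy hxy' hr
  by_cases h₁ : x ∈ X
  · exact key h₁ hx' hy hy' hxy hxy' hr
  by_cases h₂ : x' ∈ X
  · obtain ⟨h, h'⟩ := key h₂ hx hy' hy hxy' hxy hr.symm
    exact ⟨h.symm, h'.symm⟩
  · refine hY (hx.resolve_left h₁) (hx'.resolve_left h₂) (fun h => hy (Or.inr h))
      (fun h => hy' (Or.inr h)) ((hadj _ _ hxy).resolve_right fun h => hy h.2)
      ((hadj _ _ hxy').resolve_right fun h => hy' h.2) (hr.mono fun a b hab => ?_)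
    exact ⟨(hadj _ _ hab.1).resolve_right fun h => hab.2.1 h.1, fun h => hab.2.1 (Or.inr h),
      fun h => hab.2.2 (Or.inr h)⟩

end Within

/-! ### Well-founded induction along trails -/

section Trail

variable {V : Type*} {G : SimpleGraph V}

/-- One step of a trail: traverse an edge at the current vertex and delete it. -/
def TrailStep (s t : SimpleGraph V × V) : Prop :=
  t.1.Adj t.2 s.2 ∧ s.1 = t.1.deleteEdges {s(t.2, s.2)}

/-- A descending chain would be an infinite trail: an edge once traversed is absent from all later
graphs. -/
theorem acc_trailStep (h : ¬ ∃ v, IsInfiniteTrail G v) (v : V) : Acc TrailStep (G, v) := by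
  by_contra hacc
  obtain ⟨f, hf0, hf⟩ := not_acc_iff_exists_descending_chain.1 hacc
  have hanti : Antitone fun n => (f n).1 := antitone_nat_of_succ_le fun n => by
    rw [(hf n).2]
    exact SimpleGraph.deleteEdges_le _
  refine h ⟨fun n => (f n).2, fun n => ?_, ?_⟩
  · have : (f 0).1.Adj (f n).2 (f (n + 1)).2 := hanti (Nat.zero_le n) (hf n).1
    rwa [hf0] at this
  · refine Function.Injective.of_lt_imp_ne fun m n hmn heq => ?_
    have h₁ : (f (m + 1)).1.Adj (f n).2 (f (n + 1)).2 :=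
      hanti (Nat.succ_le_of_lt hmn) (hf n).1
    rw [(hf m).2, SimpleGraph.deleteEdges_adj] at h₁
    exact h₁.2 heq.symm

theorem within_compl_singleton_le (u w : V) :
    G.within {u}ᶜ ≤ G.deleteEdges {s(u, w)} := by
  intro a b hab
  rw [SimpleGraph.deleteEdges_adj]
  refine ⟨hab.1, fun h => ?_⟩
  rcases Sym2.eq_iff.1 (Set.mem_singleton_iff.1 h) with ⟨h, -⟩ | ⟨-, h⟩
  · exact hab.2.1 h
  · exact hab.2.2 h

/-- After a step along `uw`, the induction hypothesis applies at `w` in `G - uw`. It is used twice: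
to build a set around `u`, and to extend this set to `v`. -/
theorem exists_bridgeClosed_of_reachable {u : V} (hacc : Acc TrailStep (G, u)) {v : V}
    (huv : G.Reachable u v) :
    ∃ Y : Set V, Y.Finite ∧ u ∈ Y ∧ v ∈ Y ∧ G.ConnectedOn Y ∧ G.BridgeClosed Y := by
  generalize hs : (G, u) = s at hacc
  induction hacc generalizing G u v with
  | intro s _ ih =>
    subst hs
    have ih' : ∀ w, G.Adj u w → ∀ v, (G.deleteEdges {s(u, w)}).Reachable w v →
        ∃ Y : Set V, Y.Finite ∧ w ∈ Y ∧ v ∈ Y ∧ (G.deleteEdges {s(u, w)}).ConnectedOn Y ∧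
          (G.deleteEdges {s(u, w)}).BridgeClosed Y :=
      fun w hw v hv => ih (G.deleteEdges {s(u, w)}, w) ⟨hw, rfl⟩ hv rfl
    have hdel : ∀ w a b, G.Adj a b →
        (G.deleteEdges {s(u, w)}).Adj a b ∨ (a = u ∧ b = w ∨ a = w ∧ b = u) := by
      intro w a b hab
      by_cases h : s(a, b) = s(u, w)
      · exact Or.inr (Sym2.eq_iff.1 h)
      · exact Or.inl (SimpleGraph.deleteEdges_adj.2 ⟨hab, h⟩)
    obtain ⟨X, hXfin, huX, hXconn, hX⟩ : ∃ X : Set V, X.Finite ∧ u ∈ X ∧ G.ConnectedOn X ∧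
        G.BridgeClosed X := by
      -- If some edge `uw` lies on a cycle, aim the induction hypothesis at `u` itself, so that both
      -- ends of `uw` are captured. Otherwise every edge at `u` is a bridge and `{u}` suffices.
      by_cases h : ∃ w, G.Adj u w ∧ (G.deleteEdges {s(u, w)}).Reachable w u
      · obtain ⟨w, hw, hwu⟩ := h
        obtain ⟨Y, hfin, hwY, huY, hconn, hY⟩ := ih' w hw u hwu
        refine ⟨Y, hfin, huY, hconn.mono_left (SimpleGraph.deleteEdges_le _),
          hY.of_adj fun a b hab => ?_⟩
        rcases hdel w a b hab with h | ⟨rfl, rfl⟩ | ⟨rfl, rfl⟩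
        · exact Or.inl h
        · exact Or.inr ⟨huY, hwY⟩
        · exact Or.inr ⟨hwY, huY⟩
      · refine ⟨{u}, Set.finite_singleton u, rfl, ?_, ?_⟩
        · rintro a rfl b rfl
          exact .rfl
        · rintro x y x' y' rfl hx' hy hy' hxy hxy' hr
          obtain rfl : x' = x := hx'
          refine ⟨rfl, by_contra fun hne => h ⟨y, hxy, ?_⟩⟩
          refine (hr.mono (within_compl_singleton_le x' y)).trans (SimpleGraph.Adj.reachable ?_)
          refine (hdel y y' x' hxy'.symm).resolve_right ?_
          rintro (⟨h, -⟩ | ⟨h, -⟩)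
          · exact hy' h
          · exact hne h.symm
    by_cases hvu : v = u
    · exact ⟨X, hXfin, huX, hvu ▸ huX, hXconn, hX⟩
    obtain ⟨w, u', hvw, hwu, -, rfl⟩ := huv.symm.exists_adj_mem (S := {u}) hvu rfl
    obtain ⟨Y, hfin, hwY, hvY, hconn, hY⟩ := ih' w hwu.symm v
      (hvw.mono (within_compl_singleton_le u' w)).symm
    have hconn' : G.ConnectedOn (X ∪ Y) :=
      hXconn.union (hconn.mono_left (SimpleGraph.deleteEdges_le _)) huX hwY
        (SimpleGraph.Adj.reachable (by exact ⟨hwu.symm, Or.inl huX, Or.inr hwY⟩))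
    refine ⟨X ∪ Y, hXfin.union hfin, Or.inl huX, Or.inr hvY, hconn',
      hX.union hY (fun a b hab => ?_) ⟨u', huX⟩ hconn'⟩
    rcases hdel w a b hab with h | ⟨rfl, rfl⟩ | ⟨rfl, rfl⟩
    · exact Or.inl h
    · exact Or.inr ⟨Or.inl huX, Or.inr hwY⟩
    · exact Or.inr ⟨Or.inr hwY, Or.inl huX⟩

/-- In a connected graph without infinite trails every finite set of vertices extends to a finite
nonempty connected set which every component of the rest is joined to by at most one edge. -/
theorem exists_bridgeClosed_superset (hG : G.Connected) (h : ¬ ∃ v, IsInfiniteTrail G v)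
    {S : Set V} (hS : S.Finite) :
    ∃ Y : Set V, Y.Finite ∧ Y.Nonempty ∧ S ⊆ Y ∧ G.ConnectedOn Y ∧ G.BridgeClosed Y := by
  obtain ⟨u⟩ := hG.nonempty
  suffices ∃ Y : Set V, Y.Finite ∧ u ∈ Y ∧ S ⊆ Y ∧ G.ConnectedOn Y ∧ G.BridgeClosed Y by
    obtain ⟨Y, hfin, hu, h⟩ := this
    exact ⟨Y, hfin, ⟨u, hu⟩, h⟩
  have hex := fun v => exists_bridgeClosed_of_reachable (acc_trailStep h u) (hG.preconnected u v)
  induction S, hS using Set.Finite.induction_on with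
  | empty =>
    obtain ⟨Y, hfin, hu, -, h⟩ := hex u
    exact ⟨Y, hfin, hu, Set.empty_subset _, h⟩
  | @insert v S _ _ ih =>
    obtain ⟨X, hXfin, huX, hSX, hXconn, hX⟩ := ih
    obtain ⟨Y, hfin, huY, hvY, hconn, hY⟩ := hex v
    have hconn' : G.ConnectedOn (X ∪ Y) := hXconn.union hconn huX huY .rfl
    exact ⟨X ∪ Y, hXfin.union hfin, Or.inl huX,
      Set.insert_subset (Or.inr hvY) (hSX.trans Set.subset_union_left), hconn',
      hX.union hY (fun a b hab => Or.inl hab) ⟨u, huX⟩ hconn'⟩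

end Trail

/-! ### Ranks lie below κ⁺ -/

theorem rankLT_of_acc {κ : Cardinal.{u}} (hκ : ℵ₀ ≤ κ) {V : Type u} (hV : #V ≤ κ)
    {G : SimpleGraph V} {v : V} (hacc : Acc TrailStep (G, v)) :
    RankLT (Order.succ κ).ord (G.induce {w | G.Reachable v w}) := by
  have hlim : Order.IsSuccLimit (Order.succ κ).ord :=
    isSuccLimit_ord (hκ.trans (Order.le_succ κ))
  generalize hs : (G, v) = s at hacc
  induction hacc generalizing G v with
  | intro s _ ih =>
    subst hs
    have ih' : ∀ w, ∃ β < (Order.succ κ).ord, G.Adj v w → HasRank β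
        ((G.deleteEdges {s(v, w)}).induce {z | (G.deleteEdges {s(v, w)}).Reachable w z}) := by
      intro w
      by_cases hw : G.Adj v w
      · obtain ⟨β, hβ, h⟩ := ih (G.deleteEdges {s(v, w)}, w) ⟨hw, rfl⟩ rfl
        exact ⟨β, hβ, fun _ => h⟩
      -- At non-neighbours the ordinal is a dummy; it only has to lie below κ⁺.
      · exact ⟨0, hlim.bot_lt, fun h => absurd h hw⟩
    choose β hβ hrank using ih'
    have hsup : ⨆ w, Order.succ (β w) < (Order.succ κ).ord := by
      refine Ordinal.iSup_lt_of_lt_cof ?_ fun w => hlim.succ_lt (hβ w)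
      rw [(isRegular_succ hκ).cof_ord]
      exact Order.lt_succ_iff.2 hV
    refine RankLT.mono ?_ (Order.succ_le_of_lt hsup)
    rw [rankLT_succ_iff]
    -- The kernel is `v` alone: a connected set avoiding `v` lies in the component of some neighbour
    -- `w` in `G - vw`.
    refine ⟨{⟨v, .rfl⟩}, Set.finite_singleton _, fun T hT hconn => ?_⟩
    obtain ⟨t⟩ := hconn.nonempty
    have hne : ∀ t ∈ T, t.1 ≠ v := fun t ht h => hT ht (Subtype.ext h)
    obtain ⟨w, v', htw, hwv, -, rfl⟩ :=
      t.1.2.symm.exists_adj_mem (S := {v}) (hne t.1 t.2) rfl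
    refine RankLT.mono ?_ (Ordinal.le_iSup _ w)
    let f : (G.induce {w | G.Reachable v' w}).induce T →g G.within {v'}ᶜ :=
      ⟨fun x => x.1.1, fun {a b} hab => ⟨hab, hne _ a.2, hne _ b.2⟩⟩
    refine (hrank w hwv.symm).rankLT_succ.of_injective ⟨fun x => ⟨x.1.1, ?_⟩, ?_⟩ ?_
    · exact (htw.symm.trans ((hconn.preconnected t x).map f)).mono (within_compl_singleton_le _ _)
    · exact fun {a b} hab => within_compl_singleton_le v' w (f.map_rel hab)
    · intro x y hxy
      have : x.1.1 = y.1.1 := congrArg (fun z => z.1) hxy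
      exact Subtype.ext (Subtype.ext this)

/-- Every graph in `trailFree κ` has a rank below the successor of `κ`. -/
theorem rankLT_of_mem_trailFree {κ : Cardinal.{u}} (hκ : ℵ₀ ≤ κ) {G : BundledGraph.{u}}
    (hG : G ∈ trailFree κ) : RankLT (Order.succ κ).ord G.graph := by
  obtain ⟨hconn, hcard, htrail⟩ := hG
  obtain ⟨v⟩ := hconn.nonempty
  refine (rankLT_of_acc hκ hcard (acc_trailStep htrail v)).of_injective
    ⟨fun w => ⟨w, hconn.preconnected v w⟩, fun h => h⟩ fun x y hxy => ?_
  exact congrArg Subtype.val hxy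

/-! ### Gluing graphs to a base by single edges -/

section Glue

variable {A : Type*} {I : Type*} {V : I → Type*}

/-- The graph obtained from `B` and disjoint graphs `H i` by joining, for every `i`, the vertex
`root i` of `H i` to the vertex `anchor i` of `B`. -/
def glue (B : SimpleGraph A) (H : ∀ i, SimpleGraph (V i)) (anchor : I → A) (root : ∀ i, V i) :
    SimpleGraph (A ⊕ Σ i, V i) where
  Adj
    | .inl a, .inl b => B.Adj a b
    | .inl a, .inr p => a = anchor p.1 ∧ p.2 = root p.1
    | .inr p, .inl a => a = anchor p.1 ∧ p.2 = root p.1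
    | .inr p, .inr q => ∃ h : p.1 = q.1, (H q.1).Adj (h ▸ p.2) q.2
  symm := ⟨by
    rintro (a | ⟨i, z⟩) (b | ⟨j, w⟩) h
    · exact SimpleGraph.Adj.symm h
    · exact h
    · exact h
    · obtain ⟨h, h'⟩ := h
      obtain rfl : i = j := h
      exact ⟨rfl, h'.symm⟩⟩
  loopless := ⟨by
    rintro (a | ⟨i, z⟩) h
    · exact B.loopless.irrefl a h
    · exact (H i).loopless.irrefl z h.2⟩

variable {B : SimpleGraph A} {H : ∀ i, SimpleGraph (V i)} {anchor : I → A} {root : ∀ i, V i}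

theorem glue_adj_inl_inl {a b : A} :
    (glue B H anchor root).Adj (.inl a) (.inl b) ↔ B.Adj a b := Iff.rfl

theorem glue_adj_inl_inr {a : A} {i : I} {z : V i} :
    (glue B H anchor root).Adj (.inl a) (.inr ⟨i, z⟩) ↔ a = anchor i ∧ z = root i := Iff.rfl

theorem glue_adj_inr_inl {a : A} {i : I} {z : V i} :
    (glue B H anchor root).Adj (.inr ⟨i, z⟩) (.inl a) ↔ a = anchor i ∧ z = root i := Iff.rfl

theorem glue_adj_inr_inr {i : I} {z w : V i} :
    (glue B H anchor root).Adj (.inr ⟨i, z⟩) (.inr ⟨i, w⟩) ↔ (H i).Adj z w :=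
  ⟨fun ⟨_, h⟩ => h, fun h => ⟨rfl, h⟩⟩

theorem exists_eq_of_glue_adj_inr {i : I} {z : V i} {q : Σ i, V i}
    (h : (glue B H anchor root).Adj (.inr ⟨i, z⟩) (.inr q)) : ∃ w, q = ⟨i, w⟩ := by
  obtain ⟨j, w⟩ := q
  obtain rfl : i = j := h.1
  exact ⟨w, rfl⟩

/-- The inclusion of the base graph. -/
def glueInl : B →g glue B H anchor root := ⟨Sum.inl, fun h => h⟩

/-- The inclusion of one of the glued graphs. -/
def glueInr (i : I) : H i ↪g glue B H anchor root where
  toFun z := .inr ⟨i, z⟩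
  inj' z w h := by
    obtain ⟨-, h⟩ := Sigma.mk.inj (Sum.inr_injective h)
    exact eq_of_heq h
  map_rel_iff' := glue_adj_inr_inr

theorem glue_connected (hB : B.Connected) (hH : ∀ i, (H i).Connected) :
    (glue B H anchor root).Connected := by
  obtain ⟨a⟩ := hB.nonempty
  refine (SimpleGraph.connected_iff_exists_forall_reachable _).2 ⟨.inl a, ?_⟩
  rintro (b | ⟨i, z⟩)
  · exact (hB.preconnected a b).map glueInl
  · have h₁ : (glue B H anchor root).Reachable (.inl a) (.inl (anchor i)) :=
      (hB.preconnected a (anchor i)).map glueInl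
    have h₂ : (glue B H anchor root).Adj (.inl (anchor i)) (.inr ⟨i, root i⟩) :=
      glue_adj_inl_inr.2 ⟨rfl, rfl⟩
    exact (h₁.trans h₂.reachable).trans
      (((hH i).preconnected (root i) z).map (glueInr i).toHom)

/-- A trail that leaves the base for a copy could return only along the same edge, and it cannot
stay in the copy forever. Hence it remains in the base after any visit there, but the base has
finitely many edges. -/
theorem glue_no_infiniteTrail [Finite A] (hH : ∀ i, ¬ ∃ v, IsInfiniteTrail (H i) v) :
    ¬ ∃ v, IsInfiniteTrail (glue B H anchor root) v := by
  rintro ⟨v, hadj, hinj⟩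
  have stay : ∀ N i z, v N = .inr ⟨i, z⟩ → ∀ k,
      (∀ j ≤ k, ∀ a, v (N + j) ≠ .inl a) → ∃ w, v (N + k) = .inr ⟨i, w⟩ := by
    intro N i z hz k
    induction k with
    | zero => exact fun _ => ⟨z, hz⟩
    | succ k ih =>
      intro hk
      obtain ⟨w, hw⟩ := ih fun j hj => hk j (hj.trans k.le_succ)
      have hstep := hadj (N + k)
      rw [hw] at hstep
      rcases hq : v (N + k + 1) with a | q
      · exact absurd hq (hk (k + 1) le_rfl a)
      · rw [hq] at hstep
        obtain ⟨w', rfl⟩ := exists_eq_of_glue_adj_inr hstep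
        exact ⟨w', rfl⟩
  have leave : ∀ N i z, v N = .inr ⟨i, z⟩ → ∃ k a, v (N + k) = .inl a := by
    intro N i z hz
    by_contra hno
    push Not at hno
    choose w hw using fun k => stay N i z hz k fun j _ => hno j
    refine hH i ⟨w, fun n => ?_, fun m n hmn => ?_⟩
    · have h := hadj (N + n)
      rw [add_assoc, hw, hw] at h
      exact glue_adj_inr_inr.1 h
    · have h : s(v (N + m), v (N + m + 1)) = s(v (N + n), v (N + n + 1)) := by
        rw [add_assoc, add_assoc, hw, hw, hw, hw]
        exact congrArg (Sym2.map fun z => (.inr ⟨i, z⟩ : A ⊕ Σ i, V i)) hmn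
      exact Nat.add_left_cancel (hinj h)
  have step : ∀ n a, v n = .inl a → ∃ b, v (n + 1) = .inl b := by
    intro n a ha
    rcases hq : v (n + 1) with b | ⟨i, z⟩
    · exact ⟨b, rfl⟩
    exfalso
    have h₁ := hadj n
    rw [ha, hq] at h₁
    obtain ⟨rfl, rfl⟩ := glue_adj_inl_inr.1 h₁
    have hex := leave (n + 1) i _ hq
    classical
    obtain ⟨b, hb⟩ := Nat.find_spec hex
    have hmin := fun m (hm : m < Nat.find hex) => Nat.find_min hex hm
    generalize Nat.find hex = k at hb hmin
    rcases k with - | k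
    · rw [add_zero, hq] at hb
      exact Sum.inr_ne_inl hb
    obtain ⟨w, hw⟩ := stay (n + 1) i _ hq k fun j hj a h => hmin j (Nat.lt_succ_of_le hj) ⟨a, h⟩
    have h₂ := hadj (n + 1 + k)
    rw [hw, add_assoc (n + 1), hb] at h₂
    obtain ⟨rfl, rfl⟩ := glue_adj_inr_inl.1 h₂
    have heq : s(v n, v (n + 1)) = s(v (n + 1 + k), v (n + 1 + k + 1)) := by
      rw [hw, add_assoc (n + 1) k, hb, ha, hq]
      exact Sym2.eq_swap
    have := hinj heq
    omega
  obtain ⟨n, a, ha⟩ : ∃ n a, v n = .inl a := by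
    rcases hq : v 0 with a | ⟨i, z⟩
    · exact ⟨0, a, hq⟩
    · obtain ⟨k, a, h⟩ := leave 0 i z hq
      exact ⟨0 + k, a, h⟩
  have all : ∀ k, ∃ b, v (n + k) = .inl b := by
    intro k
    induction k with
    | zero => exact ⟨a, ha⟩
    | succ k ih =>
      obtain ⟨b, hb⟩ := ih
      exact step _ b hb
  choose b hb using all
  refine not_injective_infinite_finite (fun k => s(b k, b (k + 1))) fun k l hkl => ?_
  have h : s(v (n + k), v (n + k + 1)) = s(v (n + l), v (n + l + 1)) := by
    rw [add_assoc, add_assoc, hb, hb, hb, hb]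
    exact congrArg (Sym2.map (Sum.inl : A → A ⊕ Σ i, V i)) hkl
  exact Nat.add_left_cancel (hinj h)

/-- A walk from the base into a glued graph uses the edge attaching the latter. -/
theorem glue_attaching_edge_mem {x y : A ⊕ Σ i, V i} (p : (glue B H anchor root).Walk x y)
    {a : A} (hx : x = .inl a) {i : I} {z : V i} (hy : y = .inr ⟨i, z⟩) :
    s(.inl (anchor i), .inr ⟨i, root i⟩) ∈ p.edges := by
  induction p using SimpleGraph.Walk.concatRec generalizing z with
  | Hnil => exact absurd (hx.symm.trans hy) Sum.inl_ne_inr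
  | @Hconcat x w y p h ih =>
    subst hx hy
    rw [SimpleGraph.Walk.edges_concat, List.concat_eq_append, List.mem_append]
    rcases w with b | ⟨j, w⟩
    · obtain ⟨rfl, rfl⟩ := glue_adj_inl_inr.1 h
      exact Or.inr (List.mem_singleton_self _)
    · obtain ⟨w', hw⟩ := exists_eq_of_glue_adj_inr h.symm
      exact Or.inl (ih rfl (congrArg Sum.inr hw))

/-- Both the part before and the part after a visit to a copy would use its attaching edge. -/
theorem glue_trail_support {a b : A} {p : (glue B H anchor root).Walk (.inl a) (.inl b)}
    (hp : p.IsTrail) {x : A ⊕ Σ i, V i} (hx : x ∈ p.support) : ∃ c, x = .inl c := by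
  classical
  rcases x with c | ⟨i, z⟩
  · exact ⟨c, rfl⟩
  exfalso
  have hnodup := hp.edges_nodup
  rw [← p.take_spec hx, SimpleGraph.Walk.edges_append] at hnodup
  refine (List.nodup_append.1 hnodup).2.2 _ (glue_attaching_edge_mem _ rfl rfl)
    _ ?_ rfl
  have := glue_attaching_edge_mem (p.dropUntil _ hx).reverse rfl rfl
  rwa [SimpleGraph.Walk.edges_reverse, List.mem_reverse] at this

end Glue

theorem glue_rankLT {A I : Type u} {V : I → Type u} [Finite A] {B : SimpleGraph A}
    {H : ∀ i, SimpleGraph (V i)} {anchor : I → A} {root : ∀ i, V i} {α : Ordinal.{u}}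
    (hH : ∀ i, RankLT α (H i)) : RankLT (Order.succ α) (glue B H anchor root) := by
  rw [rankLT_succ_iff]
  refine ⟨Set.range Sum.inl, Set.finite_range _, fun T hT hconn => ?_⟩
  obtain ⟨t, ht⟩ := hconn.nonempty
  rcases t with a | ⟨i, z⟩
  · exact absurd ⟨a, rfl⟩ (hT ht)
  have hcopy : ∀ x : T, ∃ w, x.1 = .inr ⟨i, w⟩ := by
    intro x
    have h := hconn.preconnected ⟨_, ht⟩ x
    rw [SimpleGraph.reachable_iff_reflTransGen] at h
    induction h with
    | refl => exact ⟨z, rfl⟩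
    | @tail b c _ hbc ih =>
      obtain ⟨w, hw⟩ := ih
      obtain ⟨c | q, hc⟩ := c
      · exact absurd ⟨c, rfl⟩ (hT hc)
      · have h : (glue B H anchor root).Adj b.1 (.inr q) := hbc
        rw [hw] at h
        obtain ⟨w', rfl⟩ := exists_eq_of_glue_adj_inr h
        exact ⟨w', rfl⟩
  choose w hw using hcopy
  refine (hH i).of_injective ⟨w, fun {x y} hxy => ?_⟩ fun x y hxy => Subtype.ext ?_
  · have h : (glue B H anchor root).Adj x.1 y.1 := hxy
    rw [hw, hw] at h
    exact glue_adj_inr_inr.1 h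
  · rw [hw x, hw y]
    exact congrArg (fun z => (Sum.inr ⟨i, z⟩ : A ⊕ Σ i, V i)) hxy

theorem glue_card_le {κ : Cardinal.{u}} (hκ : ℵ₀ ≤ κ) {A I : Type u} {V : I → Type u} [Finite A]
    (hI : #I ≤ κ) (hV : ∀ i, #(V i) ≤ κ) : #(A ⊕ Σ i, V i) ≤ κ := by
  rw [mk_sum, lift_id, lift_id, mk_sigma]
  refine add_le_of_le hκ ((lt_aleph0_of_finite A).le.trans hκ) ((sum_le_sum _ _ hV).trans ?_)
  rw [sum_const']
  exact mul_le_of_le hκ hI le_rfl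

theorem IsInfiniteTrail.map {V W : Type*} {G : SimpleGraph V} {H : SimpleGraph W} {v : ℕ → V}
    (h : IsInfiniteTrail G v) (f : G ↪g H) : IsInfiniteTrail H (f ∘ v) := by
  refine ⟨fun n => f.map_rel_iff.2 (h.1 n), fun m n hmn => h.2 ?_⟩
  exact Sym2.map.injective f.injective hmn

/-! ### Embedding into a glued graph -/

section Embedding

variable {V : Type*} {G : SimpleGraph V} {X : Set V}

/-- Connectedness and bridge-closedness give each component off `X` exactly one edge to `X`, so
matching that edge determines all adjacencies with the base. The injective tags send different
components to different copies. Vertices of `X` are isolated in `G.within Xᶜ`, hence the restriction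
to components inside `Xᶜ`. -/
theorem exists_glue_embedding {A I T : Type*} {W : I → Type*} {B : SimpleGraph A}
    {H : ∀ i, SimpleGraph (W i)} {anchor : I → A} {root : ∀ i, W i} (hconn : G.Connected)
    (hne : X.Nonempty) (hX : G.BridgeClosed X) (e : G.induce X ≃g B) (tag : I → T)
    (c : (G.within Xᶜ).ConnectedComponent → T) (hc : Function.Injective c)
    (hcomp : ∀ C : (G.within Xᶜ).ConnectedComponent, C.supp ⊆ Xᶜ → ∀ (x : X) (y : C.supp),
      G.Adj x y → ∃ (i : I) (Φ : G.induce C.supp ↪g H i),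
        anchor i = e x ∧ root i = Φ y ∧ tag i = c C) :
    ∃ Φ : G ↪g glue B H anchor root, ∀ x : X, Φ x = .inl (e x) := by
  classical
  let K := G.within Xᶜ
  let comp : (Xᶜ : Set V) → {C : K.ConnectedComponent // C.supp ⊆ Xᶜ} := fun z =>
    ⟨K.connectedComponentMk z.1, fun w hw =>
      (SimpleGraph.ConnectedComponent.exact hw).symm.mem_of_within z.2⟩
  have hex : ∀ C : {C : K.ConnectedComponent // C.supp ⊆ Xᶜ}, ∃ (i : I)
      (Φ : G.induce C.1.supp ↪g H i), tag i = c C.1 ∧ ∀ (x : X) (y : C.1.supp),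
        G.Adj x y ↔ e x = anchor i ∧ Φ y = root i := by
    intro C
    obtain ⟨z, hz⟩ := C.1.nonempty_supp
    obtain ⟨x₀, hx₀⟩ := hne
    obtain ⟨y, x, hzy, hyx, -, hx⟩ :=
      (hconn.preconnected z x₀).exists_adj_mem (C.2 hz) hx₀
    have hy : y ∈ C.1.supp :=
      (SimpleGraph.ConnectedComponent.sound hzy.symm).trans hz
    obtain ⟨i, Φ, hanchor, hroot, htag⟩ := hcomp C.1 C.2 ⟨x, hx⟩ ⟨y, hy⟩ hyx.symm
    refine ⟨i, Φ, htag, fun x' y' => ⟨fun h => ?_, fun ⟨h₁, h₂⟩ => ?_⟩⟩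
    · obtain ⟨h₁, h₂⟩ := hX hx x'.2 (C.2 hy) (C.2 y'.2) hyx.symm h
        (SimpleGraph.ConnectedComponent.exact (hy.trans y'.2.symm))
      obtain rfl : x' = ⟨x, hx⟩ := Subtype.ext h₁.symm
      obtain rfl : y' = ⟨y, hy⟩ := Subtype.ext h₂.symm
      exact ⟨hanchor.symm, hroot.symm⟩
    · obtain rfl := e.injective (h₁.trans hanchor)
      obtain rfl := Φ.injective (h₂.trans hroot)
      exact hyx.symm
  choose idx Φ htag hΦ using hex
  have hidx : ∀ C D, idx C = idx D → C = D := fun C D h =>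
    Subtype.ext (hc ((htag C).symm.trans ((congrArg tag h).trans (htag D))))
  let f : V → A ⊕ Σ i, W i := fun z =>
    if h : z ∈ X then .inl (e ⟨z, h⟩) else .inr ⟨idx (comp ⟨z, h⟩), Φ (comp ⟨z, h⟩) ⟨z, rfl⟩⟩
  have hf₁ : ∀ x : X, f x = .inl (e x) := fun x => dif_pos x.2
  have hf₂ : ∀ (C : {C : K.ConnectedComponent // C.supp ⊆ Xᶜ}) (z : C.1.supp),
      f z = .inr ⟨idx C, Φ C z⟩ := by
    rintro ⟨C, hC⟩ ⟨z, hz⟩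
    have hz' : K.connectedComponentMk z = C := hz
    subst hz'
    exact dif_neg (hC hz)
  have hcases : ∀ z : V, (∃ x : X, z = x) ∨ ∃ (C : {C : K.ConnectedComponent // C.supp ⊆ Xᶜ})
      (y : C.1.supp), z = y := fun z => by
    by_cases hz : z ∈ X
    · exact Or.inl ⟨⟨z, hz⟩, rfl⟩
    · exact Or.inr ⟨comp ⟨z, hz⟩, ⟨z, rfl⟩, rfl⟩
  have hinj : Function.Injective f := by
    intro a b hab
    rcases hcases a with ⟨x, rfl⟩ | ⟨C, x, rfl⟩ <;> rcases hcases b with ⟨y, rfl⟩ | ⟨D, y, rfl⟩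
    · rw [hf₁, hf₁] at hab
      rw [e.injective (Sum.inl_injective hab)]
    · rw [hf₁, hf₂] at hab
      exact absurd hab Sum.inl_ne_inr
    · rw [hf₁, hf₂] at hab
      exact absurd hab Sum.inr_ne_inl
    · rw [hf₂, hf₂] at hab
      obtain ⟨h₁, h₂⟩ := Sigma.mk.inj (Sum.inr_injective hab)
      obtain rfl := hidx _ _ h₁
      rw [(Φ C).injective (eq_of_heq h₂)]
  refine ⟨⟨⟨f, hinj⟩, fun {a b} => ?_⟩, hf₁⟩
  change (glue B H anchor root).Adj (f a) (f b) ↔ G.Adj a b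
  rcases hcases a with ⟨x, rfl⟩ | ⟨C, x, rfl⟩ <;> rcases hcases b with ⟨y, rfl⟩ | ⟨D, y, rfl⟩
  · rw [hf₁, hf₁, glue_adj_inl_inl]
    exact e.map_rel_iff
  · rw [hf₁, hf₂, glue_adj_inl_inr, hΦ]
  · rw [hf₁, hf₂, glue_adj_inr_inl, G.adj_comm, hΦ]
  · rw [hf₂, hf₂]
    by_cases hCD : C = D
    · subst hCD
      rw [glue_adj_inr_inr]
      exact (Φ C).map_rel_iff
    · refine iff_of_false (fun h => hCD (hidx _ _ h.1)) fun h => hCD (Subtype.ext ?_)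
      have hxy : K.Adj x y := ⟨h, C.2 x.2, D.2 y.2⟩
      exact x.2.symm.trans ((SimpleGraph.ConnectedComponent.sound hxy.reachable).trans y.2)

end Embedding

/-! ### Pulling ears back along an embedding -/

section Ear

variable {V W : Type*} {G : SimpleGraph V} {H : SimpleGraph W}

theorem exists_walk_map_eq (Φ : G ↪g H) {x y : W} (p : H.Walk x y)
    (hp : ∀ w ∈ p.support, w ∈ Set.range Φ) {u v : V} (hx : Φ u = x) (hy : Φ v = y) :
    ∃ q : G.Walk u v, p = (q.map Φ.toHom).copy hx hy := by
  induction p generalizing u with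
  | nil =>
    subst hx
    obtain rfl := Φ.injective hy
    exact ⟨.nil, rfl⟩
  | cons h p ih =>
    subst hx
    obtain ⟨w, rfl⟩ := hp _ (List.mem_cons_of_mem _ p.start_mem_support)
    obtain ⟨q, rfl⟩ := ih (fun w hw => hp w (List.mem_cons_of_mem _ hw)) rfl hy
    subst hy
    exact ⟨.cons (Φ.map_rel_iff.1 h) q, rfl⟩

/-- Ears of the image of `K` come from ears of `K` if the trails between vertices of the image do
not leave the image of the whole graph. -/
theorem HasEar.of_map (Φ : G ↪g H) {K : G.Subgraph}
    (hstay : ∀ u ∈ K.verts, ∀ v ∈ K.verts, ∀ p : H.Walk (Φ u) (Φ v), p.IsTrail →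
      ∀ w ∈ p.support, w ∈ Set.range Φ)
    (h : HasEar (K.map Φ.toHom)) : HasEar K := by
  have hverts : ∀ w, Φ w ∈ (K.map Φ.toHom).verts ↔ w ∈ K.verts := fun w =>
    Φ.injective.mem_set_image
  rcases h with ⟨x, y, p, hp, hne, hsupp, hedges⟩ | ⟨x, p, hp, hsupp⟩
  · obtain ⟨u, hu, rfl⟩ := (hsupp x p.start_mem_support).2 (Or.inl rfl)
    obtain ⟨v, hv, rfl⟩ := (hsupp y p.end_mem_support).2 (Or.inr rfl)
    obtain ⟨q, rfl⟩ := exists_walk_map_eq Φ p (hstay u hu v hv p hp.isTrail) rfl rfl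
    refine Or.inl ⟨u, v, q, (SimpleGraph.Walk.isPath_map_iff_of_injective Φ.injective).1 hp,
      fun h => hne (congrArg _ h), fun w hw => ?_, fun e he heK => ?_⟩
    · have h := hsupp (Φ w) (by
        rw [SimpleGraph.Walk.support_copy, SimpleGraph.Walk.support_map]
        exact List.mem_map_of_mem hw)
      rw [hverts] at h
      exact h.trans (or_congr Φ.injective.eq_iff Φ.injective.eq_iff)
    · refine hedges (e.map Φ.toHom) ?_ ?_
      · rw [SimpleGraph.Walk.edges_copy, SimpleGraph.Walk.edges_map]
        exact List.mem_map_of_mem he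
      · rw [SimpleGraph.Subgraph.edgeSet_map]
        exact ⟨e, heK, rfl⟩
  · obtain ⟨u, hu, rfl⟩ := (hsupp x p.start_mem_support).2 rfl
    obtain ⟨q, rfl⟩ := exists_walk_map_eq Φ p (hstay u hu u hu p hp.isTrail) rfl rfl
    refine Or.inr ⟨u, q, (SimpleGraph.Walk.isCycle_map_iff_of_injective Φ.injective).1 hp,
      fun w hw => ?_⟩
    have h := hsupp (Φ w) (by
      rw [SimpleGraph.Walk.support_copy, SimpleGraph.Walk.support_map]
      exact List.mem_map_of_mem hw)
    rw [hverts] at h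
    exact h.trans Φ.injective.eq_iff

end Ear

/-! ### Construction of the families -/

/-- There is a family as required of at most `κ` graphs in the class `trailFreeBelow κ α`. -/
def HasSmallFamily (κ : Cardinal.{u}) (α : Ordinal.{u}) : Prop :=
  ∃ (ι : Type u) (f : ι → BundledGraph.{u}), #ι ≤ κ ∧ (∀ i, f i ∈ trailFreeBelow κ α) ∧
    ∀ G ∈ trailFreeBelow κ α, ∀ K : G.graph.Subgraph, K.verts.Finite →
      ∃ i, ∃ Φ : G.graph ↪g (f i).graph, ¬ HasEar K → ¬ HasEar (K.map Φ.toHom)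

theorem HasSmallFamily.succ {κ : Cardinal.{u}} (hκ : ℵ₀ ≤ κ) {β : Ordinal.{u}}
    (h : HasSmallFamily κ β) : HasSmallFamily κ (Order.succ β) := by
  obtain ⟨ι, f, hι, hf, huniv⟩ := h
  -- An index records the anchor, a member of the old family with a root, and one of κ labels that
  -- supply enough copies.
  let I : ℕ → Type u := fun n => ULift.{u} (Fin n) × (Σ j : ι, (f j).V) × κ.out
  let H : ∀ n (i : I n), SimpleGraph (f i.2.1.1).V := fun n i => (f i.2.1.1).graph
  let J : Type u := Σ n : ℕ, {B : SimpleGraph (ULift.{u} (Fin n)) // B.Connected}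
  let g : J → BundledGraph.{u} := fun B =>
    ⟨_, glue B.2.1 (H B.1) (fun i => i.1) (fun i => i.2.1.2)⟩
  have hI : ∀ n, #(I n) ≤ κ := by
    intro n
    have h₁ : #(Σ j : ι, (f j).V) ≤ κ := by
      rw [mk_sigma]
      refine (sum_le_sum _ (fun _ => κ) fun j => (hf j).1.2.1).trans ?_
      rw [sum_const']
      exact mul_le_of_le hκ hι le_rfl
    rw [mk_prod, mk_prod, lift_id, lift_id, lift_id, lift_id, mk_out]
    exact mul_le_of_le hκ ((lt_aleph0_of_finite _).le.trans hκ) (mul_le_of_le hκ h₁ le_rfl)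
  refine ⟨J, g, (mk_le_aleph0 (α := J)).trans hκ, fun B => ⟨⟨?_, ?_, ?_⟩, ?_⟩, ?_⟩
  · exact glue_connected (anchor := fun i : I B.1 => i.1) (root := fun i => i.2.1.2)
      (H := H B.1) B.2.2 fun i => (hf i.2.1.1).1.1
  · exact glue_card_le hκ (hI _) fun i => (hf _).1.2.1
  · exact glue_no_infiniteTrail (anchor := fun i : I B.1 => i.1) (root := fun i => i.2.1.2)
      (H := H B.1) fun i => (hf i.2.1.1).1.2.2
  · exact glue_rankLT (anchor := fun i : I B.1 => i.1) (root := fun i => i.2.1.2)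
      (H := H B.1) fun i => (hf i.2.1.1).2
  · rintro ⟨V, G⟩ ⟨⟨hconn, hcard, htrail⟩, hrank⟩ K hK
    obtain ⟨F, hF, hFT⟩ := rankLT_succ_iff.1 hrank
    obtain ⟨Y, hY, hne, hsub, hYconn, hYclosed⟩ :=
      exists_bridgeClosed_superset hconn htrail (hF.union hK)
    have := hY.to_subtype
    obtain ⟨n, ⟨e₀⟩⟩ := Finite.exists_equiv_fin Y
    let e : Y ≃ ULift.{u} (Fin n) := e₀.trans Equiv.ulift.symm
    let B : SimpleGraph (ULift.{u} (Fin n)) := (G.induce Y).comap e.symm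
    let eB : G.induce Y ≃g B := (SimpleGraph.Iso.comap e.symm (G.induce Y)).symm
    have hB : B.Connected := by
      have := hne.to_subtype
      have hc : (G.induce Y).Connected :=
        ⟨fun a b => (hYconn a a.2 b b.2).induce_of_within a.2 b.2⟩
      exact hc.map eB.toHom eB.surjective
    obtain ⟨c⟩ : Nonempty ((G.within Yᶜ).ConnectedComponent ↪ κ.out) := by
      rw [← Cardinal.le_def, mk_out]
      exact (mk_quot_le).trans hcard
    obtain ⟨Φ, hΦ⟩ := exists_glue_embedding (anchor := fun i : I n => i.1)
      (root := fun i : I n => i.2.1.2) (H := H n) hconn hne hYclosed eB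
      (fun i => i.2.2) c c.injective (by
        intro C hC x y hxy
        have hCconn : (G.induce C.supp).Connected :=
          C.connected_toSimpleGraph.mono (SimpleGraph.comap_monotone _ SimpleGraph.within_le)
        have hmem : (⟨C.supp, G.induce C.supp⟩ : BundledGraph.{u}) ∈ trailFreeBelow κ β := by
          refine ⟨⟨hCconn, (mk_set_le _).trans hcard, fun ⟨v, hv⟩ => htrail ⟨_, hv.map
            (SimpleGraph.Embedding.induce C.supp)⟩⟩, hFT _ (hC.trans ?_) hCconn⟩
          exact Set.compl_subset_compl.2 (Set.subset_union_left.trans hsub)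
        -- Inside the pieces only an embedding is needed, so the ear condition is invoked for the
        -- empty subgraph and discarded.
        obtain ⟨j, Ψ, -⟩ := huniv _ hmem ⊥ Set.finite_empty
        exact ⟨(eB x, ⟨j, Ψ y⟩, c C), Ψ, rfl, rfl, rfl⟩)
    refine ⟨⟨n, B, hB⟩, Φ, mt (HasEar.of_map Φ fun u hu v hv p hp w hw => ?_)⟩
    have hKY : K.verts ⊆ Y := Set.subset_union_right.trans hsub
    have hcopy : (p.copy (hΦ ⟨u, hKY hu⟩) (hΦ ⟨v, hKY hv⟩)).IsTrail := by
      rwa [SimpleGraph.Walk.isTrail_copy]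
    obtain ⟨a, rfl⟩ := glue_trail_support hcopy (by rwa [SimpleGraph.Walk.support_copy])
    exact ⟨eB.symm a, (hΦ _).trans (congrArg Sum.inl (eB.apply_symm_apply a))⟩

theorem mk_toType_le_of_lt_ord_succ {κ : Cardinal.{u}} {α : Ordinal.{u}}
    (hα : α < (Order.succ κ).ord) : #α.ToType ≤ κ := by
  rw [mk_toType]
  exact Order.lt_succ_iff.1 (lt_ord.1 hα)

/-- No separate limit case arises: a graph of rank γ < α is already served at γ + 1, and there are
at most κ such γ. -/
theorem hasSmallFamily {κ : Cardinal.{u}} (hκ : ℵ₀ ≤ κ) (α : Ordinal.{u})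
    (hα : α < (Order.succ κ).ord) : HasSmallFamily κ α := by
  induction α using WellFoundedLT.induction with
  | ind α ih =>
    have hsucc : ∀ b : α.ToType, HasSmallFamily κ (Order.succ (Ordinal.ToType.toOrd b).1) :=
      fun b => (ih _ (Ordinal.ToType.toOrd b).2 ((Ordinal.ToType.toOrd b).2.trans hα)).succ hκ
    choose ι f hι hf huniv using hsucc
    refine ⟨Σ b, ι b, fun i => f i.1 i.2, ?_, fun i => ?_, fun G hG K hK => ?_⟩
    · rw [mk_sigma]
      refine (sum_le_sum _ (fun _ => κ) hι).trans ?_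
      rw [sum_const']
      exact mul_le_of_le hκ (mk_toType_le_of_lt_ord_succ hα) le_rfl
    · obtain ⟨h₁, h₂⟩ := hf i.1 i.2
      exact ⟨h₁, RankLT.mono h₂ (Order.succ_le_of_lt (Ordinal.ToType.toOrd i.1).2)⟩
    · obtain ⟨hG, γ, hγ, hrank⟩ := hG
      obtain ⟨i, Φ, h⟩ := huniv (Ordinal.ToType.mk ⟨γ, hγ⟩) G
        ⟨hG, by simpa using (⟨γ, le_rfl, hrank⟩ : ∃ β ≤ γ, HasRank β G.graph)⟩ K hK
      exact ⟨⟨_, i⟩, Φ, h⟩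

/-! ### The diagonal graph and the main theorem -/

/-- For every small family in `trailFree κ` some graph in `trailFree κ` embeds into no member. -/
theorem exists_not_embedding {κ : Cardinal.{u}} (hκ : ℵ₀ ≤ κ) {ι : Type u}
    (f : ι → BundledGraph.{u}) (hι : #ι ≤ κ) (hf : ∀ i, f i ∈ trailFree κ) :
    ∃ G ∈ trailFree κ, ∀ i, IsEmpty (G.graph ↪g (f i).graph) := by
  have hne := fun i => (hf i).1.nonempty
  let I : Type u := ι × ULift.{u} ℕ
  let H : ∀ i : I, SimpleGraph (f i.1).V := fun i => (f i.1).graph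
  let G := glue (⊥ : SimpleGraph PUnit.{u + 1}) H (fun _ => PUnit.unit) fun i => (hne i.1).some
  have hI : #I ≤ κ := by
    rw [mk_prod, lift_id, lift_id]
    exact mul_le_of_le hκ hι ((mk_le_aleph0 (α := ULift.{u} ℕ)).trans hκ)
  refine ⟨⟨_, G⟩, ⟨?_, ?_, ?_⟩, fun i => ⟨fun Φ => ?_⟩⟩
  · exact glue_connected (anchor := fun _ => PUnit.unit)
      (root := fun i => (hne i.1).some) (H := H) .of_subsingleton fun i => (hf i.1).1
  · exact glue_card_le hκ hI fun i : I => (hf i.1).2.1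
  · exact glue_no_infiniteTrail (anchor := fun _ => PUnit.unit)
      (root := fun i => (hne i.1).some) (H := H) fun i => (hf i.1).2.2
  obtain ⟨α, -, hα⟩ := rankLT_of_mem_trailFree hκ (hf i)
  have key : ∀ β, ¬ HasRank β (f i).graph := by
    intro β
    induction β using WellFoundedLT.induction with
    | ind β ih =>
      intro hβ
      have hG : RankLT (Order.succ β) G :=
        hβ.rankLT_succ.of_injective (Φ.toHom : G →g (f i).graph) Φ.injective
      obtain ⟨F, hF, hT⟩ := rankLT_succ_iff.1 hG
      -- The finite kernel meets only finitely many of the disjoint copies of `f i`.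
      obtain ⟨n, hn⟩ : ∃ n : ℕ, ∀ z, (.inr ⟨(i, ⟨n⟩), z⟩ : PUnit ⊕ Σ i : I, (f i.1).V) ∉ F := by
        by_contra hno
        push Not at hno
        choose z hz using hno
        refine Set.infinite_of_injective_forall_mem (fun m n hmn => ?_) hz hF
        have := congrArg (fun p : I => p.2.down) (Sigma.mk.inj (Sum.inr_injective hmn)).1
        exact this
      let g : (f i).graph ↪g G := glueInr (H := H) (i, ⟨n⟩)
      let g' : (f i).graph →g G.induce (Set.range g) := ⟨fun z => ⟨g z, z, rfl⟩, g.map_rel_iff.2⟩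
      obtain ⟨γ, hγ, hrank⟩ := (hT (Set.range g) (by rintro _ ⟨z, rfl⟩; exact hn z)
        ((hf i).1.map g' (by rintro ⟨_, z, rfl⟩; exact ⟨z, rfl⟩))).of_injective g'
          fun x y hxy => g.injective (congrArg Subtype.val hxy)
      exact ih γ hγ hrank
  exact key α hα

theorem mainTheorem7 (κ : Cardinal.{u}) (hκ : ℵ₀ ≤ κ) :
    (∀ α : Ordinal.{u}, α ≠ 0 → α < (Order.succ κ).ord →
      ∃ F : Set BundledGraph.{u}, F ⊆ trailFreeBelow κ α ∧
        (∀ G ∈ trailFreeBelow κ α, ∀ K : G.graph.Subgraph, K.verts.Finite →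
          ∃ H ∈ F, ∃ Φ : G.graph ↪g H.graph,
            ¬ HasEar K → ¬ HasEar (K.map Φ.toHom)) ∧
        #F ≤ Cardinal.lift.{u + 1} κ) ∧
    strongComplexity (trailFree κ) = Cardinal.lift.{u + 1} (Order.succ κ) := by
  refine ⟨fun α _ hα => ?_, ?_⟩
  · obtain ⟨ι, f, hι, hf, huniv⟩ := hasSmallFamily hκ α hα
    refine ⟨Set.range f, by rintro _ ⟨i, rfl⟩; exact hf i, fun G hG K hK => ?_, ?_⟩
    · obtain ⟨i, Φ, h⟩ := huniv G hG K hK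
      exact ⟨f i, ⟨i, rfl⟩, Φ, h⟩
    · have h := mk_range_le_lift (f := f)
      rw [lift_id'.{u, u + 1}] at h
      exact h.trans (lift_le.2 hι)
  · obtain ⟨F₀, hF₀, hcard⟩ : ∃ F, IsStronglyUniversal F (trailFree κ) ∧
        #F ≤ Cardinal.lift.{u + 1} (Order.succ κ) := by
      have hlt : ∀ a : (Order.succ κ).ord.ToType,
          (Ordinal.ToType.toOrd a).1 < (Order.succ κ).ord := fun a => (Ordinal.ToType.toOrd a).2
      choose ι f hι hf huniv using fun a => hasSmallFamily hκ _ (hlt a)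
      refine ⟨Set.range fun i : Σ a, ι a => f i.1 i.2, ⟨?_, fun G hG => ?_⟩, ?_⟩
      · rintro _ ⟨i, rfl⟩
        exact (hf i.1 i.2).1
      · obtain ⟨β, hβ, hrank⟩ := rankLT_of_mem_trailFree hκ hG
        have hlim : Order.IsSuccLimit (Order.succ κ).ord :=
          isSuccLimit_ord (hκ.trans (Order.le_succ κ))
        obtain ⟨i, Φ, -⟩ := huniv (Ordinal.ToType.mk ⟨_, hlim.succ_lt hβ⟩) G
          ⟨hG, by simpa using (⟨β, le_rfl, hrank⟩ : ∃ γ ≤ β, HasRank γ G.graph)⟩ ⊥ Set.finite_empty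
        exact ⟨_, ⟨⟨_, i⟩, rfl⟩, ⟨Φ⟩⟩
      · have h := mk_range_le_lift (f := fun i : Σ a, ι a => f i.1 i.2)
        rw [lift_id'.{u, u + 1}] at h
        refine h.trans (lift_le.2 ?_)
        rw [mk_sigma]
        refine (sum_le_sum _ (fun _ => κ) hι).trans ?_
        rw [sum_const', mk_toType, card_ord]
        exact mul_le_of_le (hκ.trans (Order.le_succ κ)) le_rfl (Order.le_succ κ)
    have hmem : #F₀ ∈ {c | ∃ F, IsStronglyUniversal F (trailFree κ) ∧ #F = c} :=
      ⟨F₀, hF₀, rfl⟩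
    refine le_antisymm ((csInf_le' hmem).trans hcard) (le_csInf ⟨_, hmem⟩ ?_)
    rintro _ ⟨F, ⟨hsub, huniv⟩, rfl⟩
    by_contra! hlt
    rw [lift_succ, Order.lt_succ_iff] at hlt
    -- A family of size at most κ can be reindexed by a type in the lower universe, where the
    -- diagonal graph must live.
    obtain ⟨c, hcκ, hc⟩ := le_lift_iff.1 hlt
    have heq : Cardinal.lift.{u + 1} #c.out = Cardinal.lift.{u} #F := by
      rw [mk_out, hc, lift_id'.{u, u + 1}]
    obtain ⟨e⟩ := lift_mk_eq'.1 heq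
    obtain ⟨G, hG, hempty⟩ := exists_not_embedding hκ (fun i => (e i).1)
      ((mk_out c).le.trans hcκ) fun i => hsub (e i).2
    obtain ⟨H, hH, ⟨Φ⟩⟩ := huniv G hG
    obtain ⟨i, hi⟩ := e.surjective ⟨H, hH⟩
    obtain rfl : (e i).1 = H := congrArg Subtype.val hi
    exact (hempty i).false Φ
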